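/- Let $n\ge 3$, let $m_1,\dots,m_n>0$ be masses, let $m_{ij}=m_{ji}>0$ ($i\ne j$) be real coefficients and let $\alpha<-1$. Let $\mathcal X^C=\{z\in\mathbb R^n:\sum_i m_iz_i=0\}$, let $\mathbb{RP}^{n-2}$ be the space of lines through $0$ in $\mathcal X^C$, and let $X^C\subset\mathbb{RP}^{n-2}$ be the set of the classes $[z]$ with $z_i\ne z_j$ for $i\neq j$ (collinear configurations without collisions). Let $f^C\colon X^C\to\mathbb{RP}^{n-2}$ be the map $f^C[z]=[w]$, where $$w_i=\sum_{j\ne i}m_i^{-1}m_{ij}|z_i-z_j|^{\alpha}(z_i-z_j)\qquad(i=1,\dots,n).$$ Then every fixed point $p$ of $f^C$ is isolated in the set of fixed points of $f^C$, and its fixed point index is $1$. (The fixed point index of $g$ at an isolated fixed point $a$ is, in a chart, the degree of $y\mapsto (y-g(y))/\|y-g(y)\|$ on a small sphere around $a$.) Moreover, let $E^C=\{z\in\mathcal X^C:\sum_i m_iz_i^2=1\}$, let $f'(z)=\big(\sum_j m_jw_j^2\big)^{-1/2}w$ be the lifting of $f^C$ to the part of the ellipsoid $E^C$ without collisions, and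 let $x\in E^C$ be a point with $[x]=p$ a fixed point of $f^C$. Then $f'(x)=x$, the map $f'$ is differentiable at $x$, its differential $Df'(x)$ maps the tangent space $T_xE^C=\{v\in\mathcal X^C:\sum_i m_ix_iv_i=0\}$ to itself and is negative definite there for the kinetic inner product $v\cdot v'=\sum_i m_iv_iv_i'$, that is, $v\cdot Df'(x)v<0$ for every $0\ne v\in T_xE^C$; and $\det\big(I-Df'(x)|_{T_xE^C}\big)>0$. -/

import Mathlib

open scoped LinearAlgebra.Projectivization

noncomputable section

namespace CentralConf

/-! ### Singular homology and the degree of self-maps of spheres -/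

/-- The Euclidean space `ℝᵈ`. -/
abbrev Euc (d : ℕ) : Type := EuclideanSpace ℝ (Fin d)

/-- The unit sphere `S^{d-1}` of `ℝᵈ`. -/
abbrev UnitSphere (d : ℕ) : Type := Metric.sphere (0 : Euc d) 1

/-- Integral singular homology `H_q(Y; ℤ)`. -/
abbrev Homology (q : ℕ) (Y : Type) [TopologicalSpace Y] : ModuleCat.{0} ℤ :=
  ((AlgebraicTopology.singularHomologyFunctor (ModuleCat.{0} ℤ) q).obj
    (ModuleCat.of ℤ ℤ)).obj (TopCat.of Y)

/-- The homomorphism `H_q(Y; ℤ) → H_q(Z; ℤ)` induced by a continuous map. -/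
def homologyMap (q : ℕ) {Y Z : Type} [TopologicalSpace Y] [TopologicalSpace Z] (g : C(Y, Z)) :
    Homology q Y →ₗ[ℤ] Homology q Z :=
  (((AlgebraicTopology.singularHomologyFunctor (ModuleCat.{0} ℤ) q).obj
    (ModuleCat.of ℤ ℤ)).map (TopCat.ofHom g)).hom

/-- Reduced singular homology: the kernel of the map induced by `Y → point`. -/
def reducedHomology (q : ℕ) (Y : Type) [TopologicalSpace Y] : Submodule ℤ (Homology q Y) :=
  LinearMap.ker (homologyMap q (ContinuousMap.const Y PUnit.unit : C(Y, PUnit.{1})))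

/-- `g : S^{d-1} → S^{d-1}` (with `d ≥ 1`) has degree `k`: it induces multiplication by `k` on the
reduced homology group in dimension `d - 1`. (That group is infinite cyclic, so that `k` is
determined by `g`. Reduced homology is needed only for `d = 1`.) -/
def HasDegree {d : ℕ} (g : C(UnitSphere d, UnitSphere d)) (k : ℤ) : Prop :=
  ∀ c ∈ reducedHomology (d - 1) (UnitSphere d), homologyMap (d - 1) g c = k • c

/-! ### The fixed point index of an isolated fixed point -/

/-- `g : ℝᵈ → ℝᵈ` (only its values on the closed ball of centre `a` and radius `r` matter) is
continuous on the ball, `a` is its only fixed point there, and the fixed point index of `g` at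
`a` is `k`: this is the degree of `s ↦ (y - g y) / ‖y - g y‖`, `y = a + r s`, on the unit sphere. -/
structure HasIndexOnBall {d : ℕ} (g : Euc d → Euc d) (a : Euc d) (r : ℝ) (k : ℤ) : Prop where
  radius_pos : 0 < r
  continuousOn : ContinuousOn g (Metric.closedBall a r)
  fixed_iff : ∀ y ∈ Metric.closedBall a r, g y = y ↔ y = a
  degree_eq : ∃ φ : C(UnitSphere d, UnitSphere d),
    (∀ s : UnitSphere d, (φ s : Euc d) =
      ‖(a + r • (s : Euc d)) - g (a + r • (s : Euc d))‖⁻¹ •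
        ((a + r • (s : Euc d)) - g (a + r • (s : Euc d)))) ∧
    HasDegree φ k

/-- Let `N` be a topological manifold of dimension `d ≥ 1`, `D` a subset of `N` and `f : D → N`.
`HasFixedPointIndex d f p k` says that `p ∈ D` is an isolated fixed point of `f`, near which `f` is
defined and continuous, of fixed point index `k`: in a chart `e` of `N` around `p`, the map `f`
is represented on some closed ball around `e p` by a map `g` of index `k` at `e p`.
(The index depends neither on the chart nor on the ball.) -/
def HasFixedPointIndex (d : ℕ) {N : Type} [TopologicalSpace N] {D : Set N} (f : D → N) (p : D)
    (k : ℤ) : Prop :=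
  ∃ (e : OpenPartialHomeomorph N (Euc d)) (r : ℝ) (g : Euc d → Euc d),
    (p : N) ∈ e.source ∧
    (∀ y ∈ Metric.closedBall (e p) r, y ∈ e.target ∧
      ∃ h : e.symm y ∈ D, f ⟨e.symm y, h⟩ ∈ e.source ∧ e (f ⟨e.symm y, h⟩) = g y) ∧
    HasIndexOnBall g (e p) r k

/-! ### Collinear configurations -/

variable {n : ℕ}

/-- Real (that is, collinear) configurations with centre of mass `0`, collisions allowed: the
hyperplane `∑ mᵢ zᵢ = 0` of `ℝⁿ`. -/
def centered (m : Fin n → ℝ) : Submodule ℝ (Fin n → ℝ) where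
  carrier := {z | ∑ i, m i * z i = 0}
  add_mem' := by
    intro a b ha hb
    simp only [Set.mem_ofPred_eq, Pi.add_apply, mul_add, Finset.sum_add_distrib] at *
    rw [ha, hb, add_zero]
  zero_mem' := by simp
  smul_mem' := by
    intro c a ha
    simp only [Set.mem_ofPred_eq, Pi.smul_apply, smul_eq_mul] at *
    simp only [mul_left_comm _ c, ← Finset.mul_sum, ha, mul_zero]

/-- The kinetic scalar product `v · v' = ∑ mᵢ vᵢ v'ᵢ`. -/
def kinetic (m v v' : Fin n → ℝ) : ℝ := ∑ i, m i * v i * v' i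

/-- The vector `w` with `wᵢ = ∑_{j ≠ i} mᵢ⁻¹ mᵢⱼ |zᵢ - zⱼ|^α (zᵢ - zⱼ)`. -/
def forceVec (m : Fin n → ℝ) (M : Fin n → Fin n → ℝ) (α : ℝ) (z : Fin n → ℝ) : Fin n → ℝ :=
  fun i ↦ ∑ j ∈ Finset.univ.erase i, (m i)⁻¹ * M i j * |z i - z j| ^ α * (z i - z j)

variable (m : Fin n → ℝ) (M : Fin n → Fin n → ℝ) (α : ℝ)

theorem forceVec_mem (hm : ∀ i, 0 < m i) (hM : ∀ i j, M i j = M j i) (z : Fin n → ℝ) :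
    forceVec m M α z ∈ centered m := by
  change ∑ i, m i * forceVec m M α z i = 0
  have h1 : ∀ i, m i * forceVec m M α z i
      = ∑ j, M i j * |z i - z j| ^ α * (z i - z j) := by
    intro i
    rw [forceVec, Finset.mul_sum, ← Finset.add_sum_erase _ _ (Finset.mem_univ i)]
    simp only [sub_self, mul_zero, zero_add]
    refine Finset.sum_congr rfl fun j _ ↦ ?_
    have := (hm i).ne'
    field_simp
  simp only [h1]
  have h2 : ∑ i, ∑ j, M i j * |z i - z j| ^ α * (z i - z j)
      = - ∑ i, ∑ j, M i j * |z i - z j| ^ α * (z i - z j) := by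
    conv_lhs => rw [Finset.sum_comm]
    rw [← Finset.sum_neg_distrib]
    refine Finset.sum_congr rfl fun i _ ↦ ?_
    rw [← Finset.sum_neg_distrib]
    refine Finset.sum_congr rfl fun j _ ↦ ?_
    rw [hM j i, abs_sub_comm (z j) (z i)]
    ring
  linarith

/-- The map `z ↦ w` from the hyperplane `∑ mᵢ zᵢ = 0` (off the collisions) to itself. -/
def force (hm : ∀ i, 0 < m i) (hM : ∀ i j, M i j = M j i) (z : centered m) : centered m :=
  ⟨forceVec m M α z, forceVec_mem m M α hm hM z⟩

theorem force_ne_zero (hm : ∀ i, 0 < m i) (hM : ∀ i j, M i j = M j i)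
    (hpos : ∀ i j, i ≠ j → 0 < M i j) (z : centered m) (hz : z ≠ 0)
    (hinj : Function.Injective (z : Fin n → ℝ)) : force m M α hm hM z ≠ 0 := by
  intro h0
  obtain ⟨k, hk⟩ : ∃ k, (z : Fin n → ℝ) k ≠ 0 := by
    by_contra! h
    exact hz (Subtype.ext (funext h))
  have : Nonempty (Fin n) := ⟨k⟩
  obtain ⟨i, hi⟩ := Finite.exists_max (z : Fin n → ℝ)
  have hne : ∃ j, j ≠ i := by
    by_contra! h
    have hs : ∑ j, m j * (z : Fin n → ℝ) j = 0 := z.2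
    rw [Finset.sum_eq_single k (fun b _ hb ↦ absurd ((h b).trans (h k).symm) hb) (by simp)] at hs
    exact (mul_ne_zero (hm k).ne' hk) hs
  obtain ⟨j, hj⟩ := hne
  have hw : 0 < forceVec m M α z i := by
    refine Finset.sum_pos (fun j hj ↦ ?_) ⟨j, by simp [hj]⟩
    have hji : j ≠ i := (Finset.mem_erase.1 hj).1
    have hlt : 0 < (z : Fin n → ℝ) i - (z : Fin n → ℝ) j :=
      sub_pos.2 (lt_of_le_of_ne (hi j) fun h ↦ hji (hinj h))
    have := hpos i j hji.symm
    have := hm i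
    positivity
  have : forceVec m M α z i = 0 := congrFun (congrArg Subtype.val h0) i
  exact hw.ne' this

theorem force_smul (hm : ∀ i, 0 < m i) (hM : ∀ i j, M i j = M j i) (t : ℝ) (z : centered m) :
    force m M α hm hM (t • z) = (|t| ^ α * t) • force m M α hm hM z := by
  refine Subtype.ext (funext fun i ↦ ?_)
  change forceVec m M α (t • (z : Fin n → ℝ)) i = (|t| ^ α * t) * forceVec m M α z i
  simp only [forceVec, Finset.mul_sum, Pi.smul_apply, smul_eq_mul]
  refine Finset.sum_congr rfl fun j _ ↦ ?_
  rw [← mul_sub, abs_mul, Real.mul_rpow (abs_nonneg _) (abs_nonneg _)]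
  ring

/-- The projective space `ℝP^{n-2}` of lines in the hyperplane `∑ mᵢ zᵢ = 0`. -/
abbrev Proj : Type := ℙ ℝ (centered m)

/-- The quotient topology. -/
instance : TopologicalSpace (Proj m) :=
  TopologicalSpace.coinduced
    (fun v : {v : centered m // v ≠ 0} ↦ Projectivization.mk ℝ v.1 v.2) inferInstance

/-- The set `X^C ⊆ ℝP^{n-2}` of classes of collinear configurations without collisions. -/
def configSet : Set (Proj m) :=
  {p | ∃ (z : centered m) (hz : z ≠ 0),
    Function.Injective (z : Fin n → ℝ) ∧ Projectivization.mk ℝ z hz = p}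

variable {m}

theorem injective_of_mk_mem {z : centered m} {hz : z ≠ 0}
    (h : Projectivization.mk ℝ z hz ∈ configSet m) : Function.Injective (z : Fin n → ℝ) := by
  obtain ⟨y, hy, hinj, heq⟩ := h
  obtain ⟨a, rfl⟩ := (Projectivization.mk_eq_mk_iff' ℝ y z hy hz).1 heq
  intro i j hij
  refine hinj ?_
  change a * (z : Fin n → ℝ) i = a * (z : Fin n → ℝ) j
  rw [hij]

theorem injective_rep (p : configSet m) :
    Function.Injective ((p : Proj m).rep : Fin n → ℝ) := by
  have h := p.2
  rw [← Projectivization.mk_rep (p : Proj m)] at h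
  exact injective_of_mk_mem h

variable (m)

/-- The map `f^C : X^C → ℝP^{n-2}`, `[z] ↦ [w]` (see `collinearMap_mk`). -/
def collinearMap (hm : ∀ i, 0 < m i) (hM : ∀ i j, M i j = M j i)
    (hpos : ∀ i j, i ≠ j → 0 < M i j) (p : configSet m) : Proj m :=
  Projectivization.mk ℝ (force m M α hm hM (p : Proj m).rep)
    (force_ne_zero m M α hm hM hpos _ (Projectivization.rep_nonzero _) (injective_rep p))

theorem collinearMap_mk (hm : ∀ i, 0 < m i) (hM : ∀ i j, M i j = M j i)
    (hpos : ∀ i j, i ≠ j → 0 < M i j) (z : centered m) (hz : z ≠ 0)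
    (h : Projectivization.mk ℝ z hz ∈ configSet m) :
    collinearMap m M α hm hM hpos ⟨Projectivization.mk ℝ z hz, h⟩ =
      Projectivization.mk ℝ (force m M α hm hM z)
        (force_ne_zero m M α hm hM hpos z hz (injective_of_mk_mem h)) := by
  obtain ⟨a, ha⟩ := Projectivization.exists_smul_eq_mk_rep ℝ z hz
  rw [collinearMap, Projectivization.mk_eq_mk_iff']
  refine ⟨|(a : ℝ)| ^ α * a, ?_⟩
  rw [← force_smul]
  exact congrArg _ ha

/-- The formula `z ↦ w / √(∑ mⱼ wⱼ²)` for the lifting `f'` of `f^C` to the ellipsoid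
`∑ mⱼ zⱼ² = 1`, on the whole hyperplane `∑ mᵢ zᵢ = 0` off the collisions. -/
def liftedMap (hm : ∀ i, 0 < m i) (hM : ∀ i j, M i j = M j i) (z : centered m) : centered m :=
  (√(kinetic m (force m M α hm hM z) (force m M α hm hM z)))⁻¹ • force m M α hm hM z

/-- The tangent space at `x` of the ellipsoid `∑ mⱼ zⱼ² = 1` in the hyperplane `∑ mᵢ zᵢ = 0`. -/
def tangent (x : centered m) : Submodule ℝ (Fin n → ℝ) where
  carrier := {v | v ∈ centered m ∧ kinetic m x v = 0}
  add_mem' := by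
    rintro a b ⟨ha, ha'⟩ ⟨hb, hb'⟩
    refine ⟨add_mem ha hb, ?_⟩
    simp only [kinetic, Pi.add_apply, mul_add, Finset.sum_add_distrib] at *
    rw [ha', hb', add_zero]
  zero_mem' := ⟨zero_mem _, by simp [kinetic]⟩
  smul_mem' := by
    rintro c a ⟨ha, ha'⟩
    refine ⟨Submodule.smul_mem _ c ha, ?_⟩
    simp only [kinetic, Pi.smul_apply, smul_eq_mul] at *
    simp only [mul_left_comm _ c, ← Finset.mul_sum, ha', mul_zero]

variable {m} in
theorem tangent_le (x : centered m) : tangent m x ≤ centered m := fun _ hv ↦ hv.1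

end CentralConf

end

namespace CentralConf

open Topology Filter

/-! Put `Cᵢⱼ = Mᵢⱼ |zᵢ - zⱼ|^α`. The force is `lap m C z`, a weighted graph Laplacian applied to
`z`. On a line each interaction depends on the single scalar `zᵢ - zⱼ`, and `|t|^α t` has derivative
`(α + 1)|t|^α`; so the differential of the force at `z` is `α + 1` times the same Laplacian. The
Laplacian is positive definite on centred vectors for the kinetic product (`kinetic_lap_pos`), hence
for `α < -1` the differential is negative definite (`exists_hasFDerivAt_force`).

At a fixed point the force is `c x` with `c > 0`. Normalizing the force, either radially to the
ellipsoid or in the affine chart `u ↦ [x + A u]`, has on tangent vectors the differential `c⁻¹`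
times the tangential part of that of the force, so it stays negative definite.

The index needs no degree theory beyond homotopy invariance: if `Dg(a)` is negative semidefinite, `y
- g y` has positive inner product with `y - a` near `a`, so its normalization is homotopic to the
identity. This also isolates the fixed point. -/

/-! ### Degree and index from a sign condition -/

theorem homologyMap_congr {Y Z : Type} [TopologicalSpace Y] [TopologicalSpace Z] {g h : C(Y, Z)}
    (H : g.Homotopy h) (q : ℕ) : homologyMap q g = homologyMap q h := by
  have := TopCat.Homotopy.congr_homologyMap_singularChainComplexFunctor
    (f := TopCat.ofHom g) (g := TopCat.ofHom h) H (ModuleCat.of ℤ ℤ) q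
  exact congrArg ModuleCat.Hom.hom this

theorem homologyMap_id (q : ℕ) (Y : Type) [TopologicalSpace Y] :
    homologyMap q (ContinuousMap.id Y) = LinearMap.id := by
  have := (((AlgebraicTopology.singularHomologyFunctor (ModuleCat.{0} ℤ) q).obj
    (ModuleCat.of ℤ ℤ))).map_id (TopCat.of Y)
  exact congrArg ModuleCat.Hom.hom this

/-- The map `s ↦ G s / ‖G s‖` to the unit sphere. -/
noncomputable def normalize {d : ℕ} {Y : Type*} [TopologicalSpace Y] (G : Y → Euc d)
    (hG : Continuous G) (hne : ∀ s, G s ≠ 0) : C(Y, UnitSphere d) where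
  toFun s := ⟨‖G s‖⁻¹ • G s, by
    rw [mem_sphere_zero_iff_norm, norm_smul, norm_inv, norm_norm,
      inv_mul_cancel₀ (norm_ne_zero_iff.2 (hne s))]⟩
  continuous_toFun := ((hG.norm.inv₀ fun s ↦ norm_ne_zero_iff.2 (hne s)).smul hG).subtype_mk _

theorem normalize_apply {d : ℕ} {Y : Type*} [TopologicalSpace Y] (G : Y → Euc d)
    (hG : Continuous G) (hne : ∀ s, G s ≠ 0) (s : Y) :
    (normalize G hG hne s : Euc d) = ‖G s‖⁻¹ • G s :=
  rfl

/-- A self-map of the sphere that sends no point to its opposite half-sphere has degree `1`. -/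
theorem hasDegree_one_of_inner_pos {d : ℕ} (φ : C(UnitSphere d, UnitSphere d))
    (h : ∀ s : UnitSphere d, 0 < inner ℝ (s : Euc d) (φ s)) : HasDegree φ 1 := by
  have hne : ∀ p : unitInterval × UnitSphere d,
      (1 - (p.1 : ℝ)) • (p.2 : Euc d) + (p.1 : ℝ) • (φ p.2 : Euc d) ≠ 0 := by
    rintro ⟨t, s⟩ h0
    -- Paired with `s`, the segment from `s` to `φ s` gives `(1 - t) + t ⟨s, φ s⟩ > 0`, so it misses
    -- the origin.
    have h1 : inner ℝ (s : Euc d) ((1 - (t : ℝ)) • (s : Euc d) + (t : ℝ) • (φ s : Euc d)) = 0 := by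
      rw [h0, inner_zero_right]
    have hs : ‖(s : Euc d)‖ = 1 := by simp
    rw [inner_add_right, inner_smul_right, inner_smul_right, real_inner_self_eq_norm_sq, hs] at h1
    have h2 := h s
    have ht0 := t.2.1
    have ht1 := t.2.2
    rcases eq_or_lt_of_le ht0 with h3 | h3
    · rw [← h3] at h1
      norm_num at h1
    · nlinarith [mul_pos h3 h2]
  have H : ContinuousMap.Homotopy (ContinuousMap.id (UnitSphere d)) φ :=
    { toContinuousMap := normalize (fun p : unitInterval × UnitSphere d ↦
        (1 - (p.1 : ℝ)) • (p.2 : Euc d) + (p.1 : ℝ) • (φ p.2 : Euc d)) (by fun_prop) hne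
      map_zero_left := fun s ↦ by
        have hs : ‖(s : Euc d)‖ = 1 := by simp
        ext1
        simp [normalize, hs]
      map_one_left := fun s ↦ by
        have hs : ‖(φ s : Euc d)‖ = 1 := by simp
        ext1
        simp [normalize, hs] }
  intro c _
  rw [← homologyMap_congr H, homologyMap_id, one_smul, LinearMap.id_apply]

/-- A fixed point at which the differential is negative semidefinite has index `1`. -/
theorem eventually_hasIndexOnBall_one {d : ℕ} {g : Euc d → Euc d} {a : Euc d}
    {A : Euc d →L[ℝ] Euc d} (ha : g a = a) (hA : HasFDerivAt g A a)
    (hneg : ∀ v, inner ℝ v (A v) ≤ 0) (hc : ∀ᶠ y in 𝓝 a, ContinuousAt g y) :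
    ∀ᶠ r in 𝓝[>] (0 : ℝ), HasIndexOnBall g a r 1 := by
  -- Any constant below `1` would do: the remainder must not absorb the term `‖y - a‖²` of `⟨y - a,
  -- y - g y⟩`, to which the linear part contributes a nonnegative amount.
  have h1 : ∀ᶠ y in 𝓝 a, ‖g y - g a - A (y - a)‖ ≤ 1 / 2 * ‖y - a‖ :=
    hA.isLittleO.def (by norm_num)
  obtain ⟨ε, hε, hball⟩ := Metric.eventually_nhds_iff_ball.1 (h1.and hc)
  have hpos : ∀ y ∈ Metric.ball a ε, y ≠ a → 0 < inner ℝ (y - a) (y - g y) := by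
    intro y hy hya
    have h2 := (hball y hy).1
    rw [ha] at h2
    have hn : 0 < ‖y - a‖ := norm_pos_iff.2 (sub_ne_zero.2 hya)
    have h3 := real_inner_le_norm (y - a) (g y - a - A (y - a))
    have h4 : y - g y = (y - a) - A (y - a) - (g y - a - A (y - a)) := by abel
    rw [h4, inner_sub_right, inner_sub_right, real_inner_self_eq_norm_sq]
    have := hneg (y - a)
    nlinarith [mul_le_mul_of_nonneg_left h2 hn.le, mul_pos hn hn]
  filter_upwards [Ioo_mem_nhdsGT hε] with r hr
  have hsub : Metric.closedBall a r ⊆ Metric.ball a ε := Metric.closedBall_subset_ball hr.2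
  refine ⟨hr.1, fun y hy ↦ (hball y (hsub hy)).2.continuousWithinAt, fun y hy ↦ ⟨fun h ↦ ?_, ?_⟩, ?_⟩
  · by_contra hya
    have := hpos y (hsub hy) hya
    rw [h, sub_self, inner_zero_right] at this
    exact this.false
  · rintro rfl
    exact ha
  have hmem : ∀ s : UnitSphere d, a + r • (s : Euc d) ∈ Metric.closedBall a r := by
    intro s
    have hs : ‖(s : Euc d)‖ = 1 := by simp
    simp [norm_smul, hs, abs_of_pos hr.1]
  have hin : ∀ s : UnitSphere d,
      0 < inner ℝ (s : Euc d) ((a + r • (s : Euc d)) - g (a + r • (s : Euc d))) := by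
    intro s
    have hs : (s : Euc d) ≠ 0 := ne_zero_of_mem_unit_sphere s
    have := hpos _ (hsub (hmem s)) (by simp [hs, hr.1.ne'])
    rw [add_sub_cancel_left, real_inner_smul_left] at this
    exact (mul_pos_iff_of_pos_left hr.1).1 this
  have hne : ∀ s : UnitSphere d, (a + r • (s : Euc d)) - g (a + r • (s : Euc d)) ≠ 0 := by
    intro s h
    have := hin s
    rw [h, inner_zero_right] at this
    exact this.false
  have hcont : Continuous fun s : UnitSphere d ↦
      (a + r • (s : Euc d)) - g (a + r • (s : Euc d)) := by
    have h5 : Continuous fun s : UnitSphere d ↦ a + r • (s : Euc d) := by fun_prop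
    refine h5.sub (continuous_iff_continuousAt.2 fun s ↦ ?_)
    exact ContinuousAt.comp (f := fun s : UnitSphere d ↦ a + r • (s : Euc d))
      (hball _ (hsub (hmem s))).2 h5.continuousAt
  exact ⟨normalize _ hcont hne, fun s ↦ rfl, hasDegree_one_of_inner_pos _ fun s ↦ by
    rw [normalize_apply, real_inner_smul_right]
    exact mul_pos (inv_pos.2 (norm_pos_iff.2 (hne s))) (hin s)⟩

/-- `1 - D` has positive determinant if `D` is negative semidefinite for some positive definite
bilinear form. -/
theorem det_id_sub_pos {V : Type*} [AddCommGroup V] [Module ℝ V] [FiniteDimensional ℝ V]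
    (b : V →ₗ[ℝ] V →ₗ[ℝ] ℝ) (hb : ∀ v, v ≠ 0 → 0 < b v v) (D : V →ₗ[ℝ] V)
    (hD : ∀ v, b v (D v) ≤ 0) : 0 < LinearMap.det (LinearMap.id - D) := by
  let B := Module.finBasis ℝ V
  -- The path `1 - t D` starts at determinant `1` and never becomes singular: a kernel vector has `v
  -- = t D v`, so `b v v = t b v (D v) ≤ 0`.
  let p : ℝ → ℝ := fun t ↦ LinearMap.det (LinearMap.id - t • D)
  have hp : Continuous p := by
    have : p = fun t ↦ (1 - t • LinearMap.toMatrix B B D).det := by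
      funext t
      change LinearMap.det (LinearMap.id - t • D) = _
      rw [← LinearMap.det_toMatrix B, map_sub, map_smul, LinearMap.toMatrix_id]
    rw [this]
    exact Continuous.matrix_det (by fun_prop)
  have hne : ∀ t, 0 ≤ t → p t ≠ 0 := by
    intro t ht h0
    obtain ⟨v, hv, hv0⟩ := (Submodule.ne_bot_iff _).1 (LinearMap.bot_lt_ker_of_det_eq_zero h0).ne'
    have h1 : v = t • D v := sub_eq_zero.1 hv
    have h2 := hb v hv0
    nth_rewrite 2 [h1] at h2
    rw [map_smul, smul_eq_mul] at h2
    nlinarith [hD v]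
  have h0 : p 0 = 1 := by simp [p]
  have h1 : p 1 = LinearMap.det (LinearMap.id - D) := by simp [p]
  rw [← h1]
  by_contra! hle
  obtain ⟨t, ht, ht'⟩ := intermediate_value_Icc' zero_le_one hp.continuousOn
    (show (0 : ℝ) ∈ Set.Icc (p 1) (p 0) from ⟨hle, by rw [h0]; exact zero_le_one⟩)
  exact hne t ht.1 ht'

/-! ### The kinetic product and weighted Laplacians -/

variable {n : ℕ}

/-- The kinetic scalar product as a bilinear form. -/
noncomputable def kineticForm (m : Fin n → ℝ) : (Fin n → ℝ) →ₗ[ℝ] (Fin n → ℝ) →ₗ[ℝ] ℝ :=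
  LinearMap.mk₂ ℝ (kinetic m)
    (fun a b c ↦ by simp [kinetic, mul_add, add_mul, Finset.sum_add_distrib])
    (fun t a b ↦ by
      simp only [kinetic, Pi.smul_apply, smul_eq_mul, Finset.mul_sum]
      exact Finset.sum_congr rfl fun i _ ↦ by ring)
    (fun a b c ↦ by simp [kinetic, mul_add, Finset.sum_add_distrib])
    (fun t a b ↦ by
      simp only [kinetic, Pi.smul_apply, smul_eq_mul, Finset.mul_sum]
      exact Finset.sum_congr rfl fun i _ ↦ by ring)

theorem kinetic_comm (m v w : Fin n → ℝ) : kinetic m v w = kinetic m w v :=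
  Finset.sum_congr rfl fun i _ ↦ by ring

theorem kinetic_sub_right (m u v w : Fin n → ℝ) :
    kinetic m u (v - w) = kinetic m u v - kinetic m u w :=
  map_sub (kineticForm m u) v w

theorem kinetic_smul_right (m : Fin n → ℝ) (t : ℝ) (u v : Fin n → ℝ) :
    kinetic m u (t • v) = t * kinetic m u v :=
  map_smul (kineticForm m u) t v

theorem kinetic_smul_left (m : Fin n → ℝ) (t : ℝ) (u v : Fin n → ℝ) :
    kinetic m (t • u) v = t * kinetic m u v := by
  rw [kinetic_comm, kinetic_smul_right, kinetic_comm]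

theorem kinetic_self_pos {m : Fin n → ℝ} (hm : ∀ i, 0 < m i) {v : Fin n → ℝ} (hv : v ≠ 0) :
    0 < kinetic m v v := by
  obtain ⟨k, hk⟩ := Function.ne_iff.1 hv
  refine Finset.sum_pos' (fun i _ ↦ ?_) ⟨k, Finset.mem_univ k, ?_⟩
  · rw [mul_assoc]
    exact mul_nonneg (hm i).le (mul_self_nonneg _)
  · rw [mul_assoc]
    exact mul_pos (hm k) (mul_self_pos.2 hk)

/-- The weighted Laplacian `(lap m C v)ᵢ = ∑_{j ≠ i} mᵢ⁻¹ Cᵢⱼ (vᵢ - vⱼ)`. -/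
noncomputable def lap (m : Fin n → ℝ) (C : Fin n → Fin n → ℝ) : (Fin n → ℝ) →ₗ[ℝ] (Fin n → ℝ) where
  toFun v i := ∑ j ∈ Finset.univ.erase i, (m i)⁻¹ * C i j * (v i - v j)
  map_add' v w := by
    funext i
    simp only [Pi.add_apply, ← Finset.sum_add_distrib]
    exact Finset.sum_congr rfl fun j _ ↦ by ring
  map_smul' t v := by
    funext i
    simp only [Pi.smul_apply, smul_eq_mul, RingHom.id_apply, Finset.mul_sum]
    exact Finset.sum_congr rfl fun j _ ↦ by ring

/-- Average the double sum with its copy under `i ↔ j`; the masses cancel and the diagonal terms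
vanish. -/
theorem kinetic_lap {m : Fin n → ℝ} (hm : ∀ i, 0 < m i) {C : Fin n → Fin n → ℝ}
    (hC : ∀ i j, C i j = C j i) (v : Fin n → ℝ) :
    2 * kinetic m v (lap m C v) = ∑ i, ∑ j, C i j * (v i - v j) ^ 2 := by
  have h1 : kinetic m v (lap m C v) = ∑ i, ∑ j, C i j * (v i * (v i - v j)) := by
    refine Finset.sum_congr rfl fun i _ ↦ ?_
    rw [← Finset.add_sum_erase _ _ (Finset.mem_univ i)]
    simp only [lap, LinearMap.coe_mk, AddHom.coe_mk, sub_self, mul_zero, zero_add, Finset.mul_sum]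
    refine Finset.sum_congr rfl fun j _ ↦ ?_
    have := (hm i).ne'
    field_simp
  have h2 : kinetic m v (lap m C v) = ∑ i, ∑ j, C i j * (v j * (v j - v i)) := by
    rw [h1, Finset.sum_comm]
    exact Finset.sum_congr rfl fun i _ ↦ Finset.sum_congr rfl fun j _ ↦ by rw [hC]
  rw [two_mul]
  nth_rewrite 1 [h1]
  rw [h2]
  simp only [← Finset.sum_add_distrib]
  exact Finset.sum_congr rfl fun i _ ↦ Finset.sum_congr rfl fun j _ ↦ by ring

/-- The energy vanishes only on constant vectors, and the only centred constant is `0`. -/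
theorem kinetic_lap_pos {m : Fin n → ℝ} (hm : ∀ i, 0 < m i) {C : Fin n → Fin n → ℝ}
    (hC : ∀ i j, C i j = C j i) (hpos : ∀ i j, i ≠ j → 0 < C i j) {v : Fin n → ℝ}
    (hv : v ∈ centered m) (hv0 : v ≠ 0) : 0 < kinetic m v (lap m C v) := by
  obtain ⟨k, hk⟩ := Function.ne_iff.1 hv0
  obtain ⟨l, hl⟩ : ∃ l, v l ≠ v k := by
    by_contra! h
    have hs : ∑ i, m i * v i = 0 := hv
    simp only [h, ← Finset.sum_mul] at hs
    exact mul_ne_zero (Finset.sum_pos (fun i _ ↦ hm i) ⟨k, Finset.mem_univ k⟩).ne' hk hs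
  have hnn : ∀ i j, 0 ≤ C i j * (v i - v j) ^ 2 := by
    intro i j
    rcases eq_or_ne i j with rfl | hij
    · simp
    · exact mul_nonneg (hpos i j hij).le (sq_nonneg _)
  have : 0 < ∑ i, ∑ j, C i j * (v i - v j) ^ 2 :=
    Finset.sum_pos' (fun i _ ↦ Finset.sum_nonneg fun j _ ↦ hnn i j)
      ⟨l, Finset.mem_univ l, Finset.sum_pos' (fun j _ ↦ hnn l j) ⟨k, Finset.mem_univ k,
        mul_pos (hpos l k fun h ↦ hl (h ▸ rfl)) (sq_pos_of_ne_zero (sub_ne_zero.2 hl))⟩⟩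
  rw [← kinetic_lap hm hC] at this
  linarith

/-! ### The force and its differential -/

/-- The matrix `Mᵢⱼ |zᵢ - zⱼ|^α`. -/
noncomputable def stiffness (M : Fin n → Fin n → ℝ) (α : ℝ) (z : Fin n → ℝ) : Fin n → Fin n → ℝ :=
  fun i j ↦ M i j * |z i - z j| ^ α

theorem stiffness_symm {M : Fin n → Fin n → ℝ} (hM : ∀ i j, M i j = M j i) (α : ℝ)
    (z : Fin n → ℝ) (i j : Fin n) : stiffness M α z i j = stiffness M α z j i := by
  rw [stiffness, stiffness, hM, abs_sub_comm]

theorem stiffness_pos {M : Fin n → Fin n → ℝ} (hpos : ∀ i j, i ≠ j → 0 < M i j) (α : ℝ)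
    {z : Fin n → ℝ} (hz : Function.Injective z) (i j : Fin n) (hij : i ≠ j) :
    0 < stiffness M α z i j :=
  mul_pos (hpos i j hij) (Real.rpow_pos_of_pos (abs_pos.2 (sub_ne_zero.2 fun h ↦ hij (hz h))) _)

/-- The Laplacian with coefficients frozen at `z` gives the force here and, up to the factor `α +
1`, its differential in `hasFDerivAt_forceVec`. -/
theorem forceVec_eq_lap (m : Fin n → ℝ) (M : Fin n → Fin n → ℝ) (α : ℝ) (z : Fin n → ℝ) :
    forceVec m M α z = lap m (stiffness M α z) z := by
  funext i
  exact Finset.sum_congr rfl fun j _ ↦ by rw [stiffness]; ring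

theorem hasDerivAt_abs_rpow_mul (α : ℝ) {t : ℝ} (ht : t ≠ 0) :
    HasDerivAt (fun s : ℝ ↦ |s| ^ α * s) ((α + 1) * |t| ^ α) t := by
  have h := ((hasDerivAt_abs ht).rpow_const (p := α) (Or.inl (abs_ne_zero.2 ht))).mul
    (hasDerivAt_id t)
  refine h.congr_deriv ?_
  have h1 : ((SignType.sign t : SignType) : ℝ) * t = |t| := sign_mul_self t
  have h2 : |t| ^ (α - 1) * |t| = |t| ^ α := by
    rw [Real.rpow_sub_one (abs_ne_zero.2 ht), div_mul_cancel₀ _ (abs_ne_zero.2 ht)]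
  simp only [id]
  linear_combination α * |t| ^ (α - 1) * h1 + α * h2

theorem hasFDerivAt_forceVec (m : Fin n → ℝ) (M : Fin n → Fin n → ℝ) (α : ℝ) {z : Fin n → ℝ}
    (hz : Function.Injective z) :
    HasFDerivAt (forceVec m M α)
      ((α + 1) • LinearMap.toContinuousLinearMap (lap m (stiffness M α z))) z := by
  rw [hasFDerivAt_pi']
  intro i
  have h : HasFDerivAt (fun y : Fin n → ℝ ↦ ∑ j ∈ Finset.univ.erase i,
      ((m i)⁻¹ * M i j) • (|y i - y j| ^ α * (y i - y j)))
      (∑ j ∈ Finset.univ.erase i, ((m i)⁻¹ * M i j) • ((α + 1) * |z i - z j| ^ α) •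
        (ContinuousLinearMap.proj (R := ℝ) (φ := fun _ : Fin n ↦ ℝ) i -
          ContinuousLinearMap.proj j)) z := by
    refine HasFDerivAt.fun_sum fun j hj ↦ HasFDerivAt.fun_const_smul ?_ _
    have hij : z i - z j ≠ 0 := sub_ne_zero.2 fun h ↦ (Finset.mem_erase.1 hj).1 (hz h).symm
    exact (hasDerivAt_abs_rpow_mul α hij).comp_hasFDerivAt
      (f := fun y : Fin n → ℝ ↦ y i - y j) z
      ((ContinuousLinearMap.proj (R := ℝ) (φ := fun _ : Fin n ↦ ℝ) i -
          ContinuousLinearMap.proj j).hasFDerivAt)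
  refine (h.congr_fderiv ?_).congr_of_eventuallyEq (Eventually.of_forall fun y ↦ ?_)
  · ext v
    simp only [sum_apply, smul_apply,
      sub_apply, ContinuousLinearMap.proj_apply, smul_eq_mul,
      ContinuousLinearMap.comp_apply, LinearMap.coe_toContinuousLinearMap', Pi.smul_apply, lap,
      LinearMap.coe_mk, AddHom.coe_mk, Finset.mul_sum, stiffness]
    exact Finset.sum_congr rfl fun j _ ↦ by ring
  · exact Finset.sum_congr rfl fun j _ ↦ by rw [smul_eq_mul]; ring

theorem isOpen_setOf_injective : IsOpen {z : Fin n → ℝ | Function.Injective z} := by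
  have : {z : Fin n → ℝ | Function.Injective z} =
      ⋂ i, ⋂ j, {z : Fin n → ℝ | i ≠ j → z i ≠ z j} := by
    ext z
    simp only [Set.mem_iInter]
    exact ⟨fun h i j hij h' ↦ hij (h h'), fun h i j h' ↦ by_contra fun hij ↦ h i j hij h'⟩
  rw [this]
  refine isOpen_iInter_of_finite fun i ↦ isOpen_iInter_of_finite fun j ↦ ?_
  by_cases hij : i = j
  · simp [hij]
  · simp only [ne_eq, hij, not_false_eq_true, forall_const]
    exact isOpen_ne_fun (continuous_apply i) (continuous_apply j)

/-- The projection of `ℝⁿ` to the centred configurations along the constant vectors. -/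
noncomputable def centering {m : Fin n → ℝ} (hm : ∑ i, m i ≠ 0) :
    (Fin n → ℝ) →ₗ[ℝ] centered m where
  toFun w := ⟨w - fun _ ↦ (∑ i, m i * w i) / ∑ i, m i, by
    change ∑ i, m i * (w i - (∑ i, m i * w i) / ∑ i, m i) = 0
    simp only [mul_sub, Finset.sum_sub_distrib, ← Finset.sum_mul]
    field_simp
    ring⟩
  map_add' v w := by
    ext i
    simp [mul_add, Finset.sum_add_distrib, add_div]
    ring
  map_smul' t v := by
    ext i
    simp only [Pi.smul_apply, smul_eq_mul, RingHom.id_apply, mul_left_comm _ t, ← Finset.mul_sum,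
      Pi.sub_apply, Submodule.coe_smul]
    ring

theorem centering_coe {m : Fin n → ℝ} (hm : ∑ i, m i ≠ 0) (w : centered m) :
    centering hm (w : Fin n → ℝ) = w := by
  ext i
  have : ∑ i, m i * (w : Fin n → ℝ) i = 0 := w.2
  simp [centering, this]

/-- Constant vectors are kinetically orthogonal to the centred ones. -/
theorem kinetic_centering {m : Fin n → ℝ} (hm : ∑ i, m i ≠ 0) {v : Fin n → ℝ}
    (hv : v ∈ centered m) (w : Fin n → ℝ) : kinetic m v (centering hm w) = kinetic m v w := by
  have h : ∑ i, m i * v i = 0 := hv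
  change ∑ i, m i * v i * (w i - (∑ i, m i * w i) / ∑ i, m i) = ∑ i, m i * v i * w i
  simp only [mul_sub, Finset.sum_sub_distrib, ← Finset.sum_mul, h, zero_mul, sub_zero]

variable {m : Fin n → ℝ} {M : Fin n → Fin n → ℝ} {α : ℝ}

/-- The force is differentiable off the collisions and, for `α < -1`, its differential is
negative definite. -/
theorem exists_hasFDerivAt_force (hα : α < -1) (hm : ∀ i, 0 < m i) (hM : ∀ i j, M i j = M j i)
    (hpos : ∀ i j, i ≠ j → 0 < M i j) {z : centered m}
    (hz : Function.Injective (z : Fin n → ℝ)) :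
    ∃ L : centered m →L[ℝ] centered m, HasFDerivAt (force m M α hm hM) L z ∧
      ∀ v : centered m, v ≠ 0 → kinetic m v (L v) < 0 := by
  -- For `n = 0` the total mass is `0` and `centering` is unavailable, but the space is trivial.
  rcases isEmpty_or_nonempty (Fin n) with hn | hn
  · refine ⟨0, hasFDerivAt_of_subsingleton _ _, fun v hv ↦ absurd (Subsingleton.elim _ _) hv⟩
  have hs : ∑ i, m i ≠ 0 := (Finset.sum_pos (fun i _ ↦ hm i) Finset.univ_nonempty).ne'
  -- Since `P` is the identity on centred vectors, composing with it turns the derivative in `ℝⁿ`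
  -- into one with values in the hyperplane.
  let P := LinearMap.toContinuousLinearMap (centering hs)
  refine ⟨P.comp (((α + 1) • LinearMap.toContinuousLinearMap (lap m (stiffness M α z))).comp
    (centered m).subtypeL), ?_, fun v hv ↦ ?_⟩
  · have h := P.hasFDerivAt.comp z ((hasFDerivAt_forceVec m M α hz).comp z
      (centered m).subtypeL.hasFDerivAt)
    refine h.congr_of_eventuallyEq (Eventually.of_forall fun y ↦ ?_)
    exact (centering_coe hs (force m M α hm hM y)).symm
  · change kinetic m v (centering hs ((α + 1) • lap m (stiffness M α z) v)) < 0
    rw [kinetic_centering hs v.2, kinetic_smul_right]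
    exact mul_neg_of_neg_of_pos (by linarith) (kinetic_lap_pos hm (stiffness_symm hM α z)
      (stiffness_pos hpos α hz) v.2 fun h ↦ hv (Subtype.ext h))

theorem kinetic_force_pos (hm : ∀ i, 0 < m i) (hM : ∀ i j, M i j = M j i)
    (hpos : ∀ i j, i ≠ j → 0 < M i j) {z : centered m}
    (hz : Function.Injective (z : Fin n → ℝ)) (hz0 : z ≠ 0) :
    0 < kinetic m z (force m M α hm hM z) := by
  change 0 < kinetic m z (forceVec m M α z)
  rw [forceVec_eq_lap]
  exact kinetic_lap_pos hm (stiffness_symm hM α z) (stiffness_pos hpos α hz) z.2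
    fun h ↦ hz0 (Subtype.ext h)

/-! ### Fixed points and the lifted map -/

/-- Over a fixed point of `f^C` the force is a positive multiple of the configuration. -/
theorem exists_force_eq_smul (hm : ∀ i, 0 < m i) (hM : ∀ i j, M i j = M j i)
    (hpos : ∀ i j, i ≠ j → 0 < M i j) {p : configSet m}
    (hp : collinearMap m M α hm hM hpos p = p) {x : centered m} (hx : x ≠ 0)
    (hxp : Projectivization.mk ℝ x hx = p) :
    ∃ c : ℝ, 0 < c ∧ force m M α hm hM x = c • x := by
  obtain ⟨p, hpX⟩ := p
  subst hxp
  rw [collinearMap_mk, Projectivization.mk_eq_mk_iff'] at hp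
  obtain ⟨c, hc⟩ := hp
  refine ⟨c, ?_, hc.symm⟩
  -- Equality of lines only gives a real `c`; pairing with `x` determines its sign.
  have h := kinetic_force_pos (α := α) hm hM hpos (injective_of_mk_mem hpX) hx
  rw [← hc, Submodule.coe_smul, kinetic_smul_right] at h
  exact (mul_pos_iff_of_pos_right (kinetic_self_pos hm fun h ↦ hx (Subtype.ext h))).1 h

theorem hasFDerivAt_kinetic_self {E : Type*} [NormedAddCommGroup E] [NormedSpace ℝ E]
    {F : E → centered m} {L : E →L[ℝ] centered m} {x : E} (hF : HasFDerivAt F L x) :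
    ∃ K : E →L[ℝ] ℝ, HasFDerivAt (fun y ↦ kinetic m (F y) (F y)) K x ∧
      ∀ v, K v = 2 * kinetic m (F x) (L v) := by
  have h1 : ∀ i, HasFDerivAt (fun y ↦ (F y : Fin n → ℝ) i)
      (((ContinuousLinearMap.proj (R := ℝ) (φ := fun _ : Fin n ↦ ℝ) i).comp
        (centered m).subtypeL).comp L) x := fun i ↦
    ((ContinuousLinearMap.proj (R := ℝ) (φ := fun _ : Fin n ↦ ℝ) i).comp
      (centered m).subtypeL).hasFDerivAt.comp x hF
  refine ⟨_, HasFDerivAt.fun_sum fun i _ ↦ ((h1 i).const_mul (m i)).mul (h1 i), fun v ↦ ?_⟩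
  simp only [sum_apply, add_apply, smul_apply, smul_eq_mul, ContinuousLinearMap.comp_apply,
    ContinuousLinearMap.proj_apply, Submodule.subtypeL_apply, kinetic, Finset.mul_sum]
  exact Finset.sum_congr rfl fun i _ ↦ by ring

theorem liftedMap_eq_self {hm : ∀ i, 0 < m i} {hM : ∀ i j, M i j = M j i} {x : centered m} {c : ℝ}
    (hc : 0 < c) (hF : force m M α hm hM x = c • x) (hx1 : kinetic m x x = 1) :
    liftedMap m M α hm hM x = x := by
  rw [liftedMap, hF, Submodule.coe_smul, kinetic_smul_left, kinetic_smul_right, hx1, mul_one,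
    Real.sqrt_mul_self hc.le, smul_smul, inv_mul_cancel₀ hc.ne', one_smul]

/-- The differential of the lifted map at a central configuration: on tangent vectors it is, up to
a positive factor and a normal component, the differential of the force. -/
theorem hasFDerivAt_liftedMap {hm : ∀ i, 0 < m i} {hM : ∀ i j, M i j = M j i} {x : centered m}
    {c : ℝ} (hc : 0 < c) (hF : force m M α hm hM x = c • x) (hx1 : kinetic m x x = 1)
    {L : centered m →L[ℝ] centered m} (hL : HasFDerivAt (force m M α hm hM) L x) :
    ∃ L' : centered m →L[ℝ] centered m, HasFDerivAt (liftedMap m M α hm hM) L' x ∧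
      ∀ v, L' v = c⁻¹ • (L v - kinetic m x (L v) • x) := by
  obtain ⟨K, hK, hKv⟩ := hasFDerivAt_kinetic_self hL
  have hN : kinetic m (force m M α hm hM x) (force m M α hm hM x) = c * c := by
    rw [hF, Submodule.coe_smul, kinetic_smul_left, kinetic_smul_right, hx1, mul_one]
  have hsq := (hK.sqrt (by rw [hN]; exact (mul_pos hc hc).ne'))
  have hinv := (hasDerivAt_inv (x := √(kinetic m (force m M α hm hM x) (force m M α hm hM x)))
    (by rw [hN, Real.sqrt_mul_self hc.le]; exact hc.ne')).comp_hasFDerivAt x hsq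
  -- With `N = w · w = c²` and `DN v = 2c (x · L v)`, the derivative of `N^(-1/2)` is `-c⁻² (x · L
  -- v)`; multiplied by `w = c x` it gives the normal correction.
  refine ⟨_, hinv.smul hL, fun v ↦ ?_⟩
  simp only [add_apply, smul_apply, ContinuousLinearMap.smulRight_apply, hKv, hF,
    Submodule.coe_smul, kinetic_smul_left, kinetic_smul_right, hx1, mul_one,
    Real.sqrt_mul_self hc.le, smul_eq_mul,
    Function.comp_apply, smul_smul, smul_sub]
  rw [sub_eq_add_neg, ← neg_smul]
  congr 2
  field_simp

/-! ### Orthonormal frame and affine chart -/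

/-- The tangent space of the ellipsoid has an orthonormal basis: `A` embeds `ℝ^{n-2}` isometrically
onto it, and `B` is the adjoint of `A`. -/
theorem exists_tangent_frame (hm : ∀ i, 0 < m i) {x : centered m} (hx1 : kinetic m x x = 1) :
    ∃ (A : Euc (n - 2) →L[ℝ] centered m) (B : centered m →L[ℝ] Euc (n - 2)),
      (∀ u, B (A u) = u) ∧ (∀ z, A (B z) = z - kinetic m x z • x) ∧
      (∀ u v, kinetic m (A u) (A v) = inner ℝ u v) := by
  have hsq : ∀ i, √(m i) * √(m i) = m i := fun i ↦ Real.mul_self_sqrt (hm i).le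
  have hs0 : ∀ i, √(m i) ≠ 0 := fun i ↦ (Real.sqrt_pos.2 (hm i)).ne'
  -- Scaling by `√mᵢ` makes the kinetic product Euclidean; the tangent space becomes the orthogonal
  -- complement of `J o` and `J x`, with `o` the all-ones vector.
  let J : (Fin n → ℝ) →ₗ[ℝ] Euc n :=
    { toFun := fun z ↦ WithLp.toLp 2 fun i ↦ √(m i) * z i
      map_add' := fun a b ↦ by ext i; simp [mul_add]
      map_smul' := fun t a ↦ by ext i; simp [mul_left_comm] }
  let J' : Euc n →ₗ[ℝ] (Fin n → ℝ) :=
    { toFun := fun w i ↦ (√(m i))⁻¹ * w i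
      map_add' := fun a b ↦ by ext i; simp [mul_add]
      map_smul' := fun t a ↦ by ext i; simp [mul_left_comm] }
  have hJ'J : ∀ z, J' (J z) = z := fun z ↦ by
    funext i
    exact inv_mul_cancel_left₀ (hs0 i) _
  have hJJ' : ∀ w, J (J' w) = w := fun w ↦ by
    ext i
    exact mul_inv_cancel_left₀ (hs0 i) _
  have hJ : ∀ z y, inner ℝ (J z) (J y) = kinetic m z y := fun z y ↦ by
    simp only [PiLp.inner_apply, kinetic, J, LinearMap.coe_mk, AddHom.coe_mk, RCLike.inner_apply,
      conj_trivial]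
    exact Finset.sum_congr rfl fun i _ ↦ by linear_combination z i * y i * hsq i
  let o : Fin n → ℝ := fun _ ↦ 1
  have hcent : ∀ z, z ∈ centered m ↔ kinetic m o z = 0 := fun z ↦ by
    change ∑ i, m i * z i = 0 ↔ ∑ i, m i * 1 * z i = 0
    simp only [mul_one]
  have ho : o ≠ 0 := by
    intro h
    have hx0 : (x : Fin n → ℝ) = 0 := funext fun i ↦ absurd (congrFun h i) one_ne_zero
    rw [hx0] at hx1
    simp [kinetic] at hx1
  let b : Fin 2 → Euc n := ![J o, J x]
  have hox : inner ℝ (J o) (J x) = 0 := by rw [hJ]; exact (hcent _).1 x.2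
  have hb : LinearIndependent ℝ b := by
    refine linearIndependent_of_ne_zero_of_inner_eq_zero (𝕜 := ℝ) (fun i ↦ ?_) fun i j hij ↦ ?_
    · fin_cases i
      · intro h
        have : J o = 0 := h
        exact ho (by rw [← hJ'J o, this, map_zero])
      · intro h
        have : J x = 0 := h
        have h1 := hJ x x
        rw [this, inner_zero_left, hx1] at h1
        exact zero_ne_one h1
    · fin_cases i <;> fin_cases j
      · exact absurd rfl hij
      · exact hox
      · exact (real_inner_comm _ _).trans hox
      · exact absurd rfl hij
  let K : Submodule ℝ (Euc n) := Submodule.span ℝ (Set.range b)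
  have hK : Module.finrank ℝ K = 2 := by
    rw [finrank_span_eq_card hb, Fintype.card_fin]
  -- Two independent vectors force `2 ≤ n`, so the subtraction is not truncated.
  have hKo : Module.finrank ℝ Kᗮ = n - 2 := by
    have := K.finrank_add_finrank_orthogonal
    rw [hK, finrank_euclideanSpace_fin] at this
    omega
  have hmem : ∀ w, w ∈ Kᗮ ↔ inner ℝ (J o) w = 0 ∧ inner ℝ (J x) w = 0 := by
    intro w
    have hr : Set.range b = {J o, J x} := Matrix.range_cons_cons_empty _ _ _
    rw [Submodule.mem_orthogonal]
    refine ⟨fun h ↦ ⟨h _ (Submodule.subset_span ⟨0, rfl⟩), h _ (Submodule.subset_span ⟨1, rfl⟩)⟩,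
      fun h u hu ↦ ?_⟩
    obtain ⟨s, t, rfl⟩ := Submodule.mem_span_pair.1 (show u ∈ Submodule.span ℝ {J o, J x} by
      rw [← hr]; exact hu)
    rw [inner_add_left, real_inner_smul_left, real_inner_smul_left, h.1, h.2]
    simp
  let R : Kᗮ ≃ₗᵢ[ℝ] Euc (n - 2) :=
    ((stdOrthonormalBasis ℝ Kᗮ).reindex (finCongr hKo)).repr
  let A : Euc (n - 2) →ₗ[ℝ] centered m :=
    LinearMap.codRestrict (centered m)
      (J' ∘ₗ Kᗮ.subtype ∘ₗ R.symm.toLinearEquiv.toLinearMap) fun u ↦ by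
        rw [hcent, ← hJ]
        change inner ℝ (J o) (J (J' (R.symm u : Euc n))) = 0
        rw [hJJ']
        exact ((hmem _).1 (R.symm u).2).1
  have hA : ∀ u, J (A u) = (R.symm u : Euc n) := fun u ↦ hJJ' _
  let Q : centered m →ₗ[ℝ] Kᗮ :=
    LinearMap.codRestrict Kᗮ (J ∘ₗ ((centered m).subtype -
      ((kineticForm m x ∘ₗ (centered m).subtype).smulRight (x : Fin n → ℝ)))) fun z ↦ by
        change J ((z : Fin n → ℝ) - kinetic m x z • (x : Fin n → ℝ)) ∈ Kᗮ
        rw [hmem, hJ, hJ, kinetic_sub_right, kinetic_sub_right, kinetic_smul_right,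
          kinetic_smul_right, hx1, (hcent _).1 z.2, (hcent _).1 x.2]
        simp
  have hQ : ∀ z : centered m, (Q z : Euc n) =
      J ((z : Fin n → ℝ) - kinetic m x z • (x : Fin n → ℝ)) := fun z ↦ rfl
  have hxA : ∀ u, kinetic m x (A u) = 0 := fun u ↦ by
    rw [← hJ, hA]
    exact ((hmem _).1 (R.symm u).2).2
  refine ⟨LinearMap.toContinuousLinearMap A,
    LinearMap.toContinuousLinearMap (R.toLinearEquiv.toLinearMap ∘ₗ Q),
    fun u ↦ ?_, fun z ↦ ?_, fun u v ↦ ?_⟩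
  · change R (Q (A u)) = u
    rw [← R.symm_apply_eq.trans eq_comm]
    refine Subtype.ext ?_
    rw [hQ, hxA, zero_smul, sub_zero, hA]
  · change A (R (Q z)) = _
    refine Subtype.ext ?_
    change J' (R.symm (R (Q z)) : Euc n) = _
    rw [R.symm_apply_apply, hQ, hJ'J]
    rfl
  · change kinetic m (A u) (A v) = _
    rw [← hJ, hA, hA]
    exact R.symm.inner_map_map u v

theorem isQuotientMap_mk (m : Fin n → ℝ) : IsQuotientMap
    (fun v : {v : centered m // v ≠ 0} ↦ Projectivization.mk ℝ v.1 v.2) :=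
  ⟨⟨rfl⟩, fun p ↦ ⟨⟨p.rep, p.rep_nonzero⟩, p.mk_rep⟩⟩

/-- The affine chart `[z] ↦ (ℓ z)⁻¹ B z` of the projective space, with inverse `u ↦ [x + A u]`. -/
theorem exists_affine_chart {d : ℕ} (x : centered m) (ℓ : centered m →L[ℝ] ℝ)
    (A : Euc d →L[ℝ] centered m) (B : centered m →L[ℝ] Euc d) (hx : ℓ x = 1) (hA : ∀ u, ℓ (A u) = 0)
    (hBx : B x = 0) (hBA : ∀ u, B (A u) = u) (hAB : ∀ z, A (B z) = z - ℓ z • x) :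
    ∃ e : OpenPartialHomeomorph (Proj m) (Euc d), e.target = Set.univ ∧
      (∀ z hz, Projectivization.mk ℝ z hz ∈ e.source ↔ ℓ z ≠ 0) ∧
      (∀ z hz, e (Projectivization.mk ℝ z hz) = (ℓ z)⁻¹ • B z) ∧
      ∀ u (hu : x + A u ≠ 0), e.symm u = Projectivization.mk ℝ (x + A u) hu := by
  have hℓ : ∀ u, ℓ (x + A u) = 1 := fun u ↦ by rw [map_add, hx, hA, add_zero]
  have hne : ∀ u, x + A u ≠ 0 := fun u h ↦ by
    have := hℓ u
    rw [h, map_zero] at this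
    exact zero_ne_one this
  -- The quotient is homogeneous of degree `0`, so the choice of representative is immaterial.
  let f : Proj m → Euc d := fun p ↦ (ℓ p.rep)⁻¹ • B p.rep
  let S : Set (Proj m) := {p | ℓ p.rep ≠ 0}
  have hS : ∀ z hz, Projectivization.mk ℝ z hz ∈ S ↔ ℓ z ≠ 0 := fun z hz ↦ by
    obtain ⟨a, ha⟩ := Projectivization.exists_smul_eq_mk_rep ℝ z hz
    change ℓ (Projectivization.mk ℝ z hz).rep ≠ 0 ↔ ℓ z ≠ 0
    rw [← ha, Units.smul_def, map_smul, smul_eq_mul, mul_ne_zero_iff]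
    exact and_iff_right a.ne_zero
  have hf : ∀ z hz, f (Projectivization.mk ℝ z hz) = (ℓ z)⁻¹ • B z := fun z hz ↦ by
    obtain ⟨a, ha⟩ := Projectivization.exists_smul_eq_mk_rep ℝ z hz
    change (ℓ (Projectivization.mk ℝ z hz).rep)⁻¹ • B (Projectivization.mk ℝ z hz).rep = _
    rw [← ha, Units.smul_def, map_smul, map_smul, smul_eq_mul, smul_smul, mul_inv_rev, mul_assoc,
      inv_mul_cancel₀ a.ne_zero, mul_one]
  have hq := isQuotientMap_mk m
  have hSo : IsOpen S := by
    rw [← hq.isOpen_preimage]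
    have : (fun v : {v : centered m // v ≠ 0} ↦ Projectivization.mk ℝ v.1 v.2) ⁻¹' S =
        {v | ℓ v.1 ≠ 0} := by
      ext v
      exact hS v.1 v.2
    rw [this]
    exact isOpen_ne_fun (by fun_prop) continuous_const
  refine ⟨{ toFun := f
            invFun := fun u ↦ Projectivization.mk ℝ (x + A u) (hne u)
            source := S
            target := Set.univ
            map_source' := fun _ _ ↦ Set.mem_univ _
            map_target' := fun u _ ↦ (hS _ _).2 (by rw [hℓ]; exact one_ne_zero)
            left_inv' := ?_
            right_inv' := fun u _ ↦ by
              rw [hf, hℓ, map_add, hBx, hBA, zero_add, inv_one, one_smul]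
            open_source := hSo
            open_target := isOpen_univ
            continuousOn_toFun := ?_
            continuousOn_invFun := ?_ }, rfl, hS, hf, fun u hu ↦ rfl⟩
  · intro p hp
    induction p using Projectivization.ind with
    | h z hz =>
      have h0 := (hS z hz).1 hp
      rw [Projectivization.mk_eq_mk_iff']
      -- Rescaling `z` to `ℓ = 1` lands on the affine slice `x + A u`.
      refine ⟨(ℓ z)⁻¹, ?_⟩
      rw [hf, map_smul, hAB, smul_sub, smul_smul, inv_mul_cancel₀ h0, one_smul]
      abel
  · rw [continuousOn_iff_continuous_domRestrict]
    refine (hq.restrictPreimage_isOpen hSo).continuous_iff.2 ?_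
    have : S.domRestrict f ∘ S.restrictPreimage
        (fun v : {v : centered m // v ≠ 0} ↦ Projectivization.mk ℝ v.1 v.2) =
        fun v ↦ (ℓ v.1.1)⁻¹ • B v.1.1 := by
      funext v
      exact hf v.1.1 v.1.2
    rw [this]
    exact Continuous.smul (Continuous.inv₀ (by fun_prop) fun v ↦ (hS _ _).1 v.2) (by fun_prop)
  · refine Continuous.continuousOn (hq.continuous.comp (f := fun u ↦
      (⟨x + A u, hne u⟩ : {v : centered m // v ≠ 0})) ?_)
    exact Continuous.subtype_mk (by fun_prop) _

/-! ### Index of the fixed points of `f^C` -/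

/-- A fixed point of index `k` is isolated among the fixed points. -/
theorem HasFixedPointIndex.exists_nhds {d : ℕ} {N : Type} [TopologicalSpace N] {D : Set N}
    {f : D → N} {p : D} {k : ℤ} (h : HasFixedPointIndex d f p k) :
    ∃ W ∈ 𝓝 p, ∀ q ∈ W, f q = q → q = p := by
  obtain ⟨e, r, g, hp, hg, hi⟩ := h
  refine ⟨Subtype.val ⁻¹' (e.source ∩ e ⁻¹' Metric.closedBall (e p) r),
    continuous_subtype_val.continuousAt.preimage_mem_nhds (inter_mem (e.open_source.mem_nhds hp)
      ((e.continuousAt hp).preimage_mem_nhds (Metric.closedBall_mem_nhds _ hi.radius_pos))),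
    fun q hq hfq ↦ ?_⟩
  obtain ⟨_, hD, _, hgq⟩ := hg (e q) hq.2
  have hqq : (⟨e.symm (e q), hD⟩ : D) = q := Subtype.ext (e.left_inv hq.1)
  rw [hqq, hfq] at hgq
  exact Subtype.ext (e.injOn hq.1 hp ((hi.fixed_iff _ hq.2).1 hgq.symm))

theorem exists_kinetic_self_eq_one (hm : ∀ i, 0 < m i) (p : Proj m) :
    ∃ (x : centered m) (hx : x ≠ 0), Projectivization.mk ℝ x hx = p ∧ kinetic m x x = 1 := by
  have h0 : 0 < kinetic m p.rep p.rep :=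
    kinetic_self_pos hm fun h ↦ p.rep_nonzero (Subtype.ext h)
  have hr : (√(kinetic m p.rep p.rep))⁻¹ ≠ 0 := (inv_pos.2 (Real.sqrt_pos.2 h0)).ne'
  refine ⟨(√(kinetic m p.rep p.rep))⁻¹ • p.rep, smul_ne_zero hr p.rep_nonzero, ?_, ?_⟩
  · conv_rhs => rw [← p.mk_rep]
    rw [Projectivization.mk_eq_mk_iff']
    exact ⟨_, rfl⟩
  · rw [Submodule.coe_smul, kinetic_smul_left, kinetic_smul_right, ← mul_assoc, ← mul_inv,
      Real.mul_self_sqrt h0.le, inv_mul_cancel₀ h0.ne']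

/-- Every fixed point of `f^C` has index `1`. -/
theorem hasFixedPointIndex_collinearMap (hα : α < -1) (hm : ∀ i, 0 < m i)
    (hM : ∀ i j, M i j = M j i) (hpos : ∀ i j, i ≠ j → 0 < M i j) (p : configSet m)
    (hp : collinearMap m M α hm hM hpos p = p) :
    HasFixedPointIndex (n - 2) (collinearMap m M α hm hM hpos) p 1 := by
  obtain ⟨x, hx, hxp, hx1⟩ := exists_kinetic_self_eq_one hm p
  obtain ⟨c, hc, hF⟩ := exists_force_eq_smul hm hM hpos hp hx hxp
  obtain ⟨A, B, hBA, hAB, hAi⟩ := exists_tangent_frame hm hx1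
  let ℓ : centered m →L[ℝ] ℝ := LinearMap.toContinuousLinearMap
    (kineticForm m x ∘ₗ (centered m).subtype)
  have hℓx : ℓ x = 1 := hx1
  have hBx : B x = 0 := by
    rw [← hBA (B x), hAB, hx1, one_smul, sub_self, map_zero]
  have hℓA : ∀ u, ℓ (A u) = 0 := fun u ↦ by
    have h := hAB (A u)
    rw [hBA, eq_comm, sub_eq_self, smul_eq_zero] at h
    exact h.resolve_right hx
  have hadj : ∀ u (z : centered m), kinetic m (A u) z = inner ℝ u (B z) := fun u z ↦ by
    have h0 : kinetic m (A u) x = 0 := (kinetic_comm _ _ _).trans (hℓA u)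
    rw [← hAi, hAB, Submodule.coe_sub, Submodule.coe_smul, kinetic_sub_right, kinetic_smul_right,
      h0, mul_zero, sub_zero]
  obtain ⟨e, he, heS, hef, hes⟩ := exists_affine_chart x ℓ A B hℓx hℓA hBx hBA hAB
  let F := force m M α hm hM
  have hFx : F x = c • x := hF
  have hxinj : Function.Injective (x : Fin n → ℝ) :=
    injective_of_mk_mem (hz := hx) (by rw [hxp]; exact p.2)
  let s : Euc (n - 2) → centered m := fun u ↦ x + A u
  have hs0 : s 0 = x := by simp [s]
  have hs : ∀ u, HasFDerivAt s A u := fun u ↦ A.hasFDerivAt.const_add x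
  have hsne : ∀ u, s u ≠ 0 := fun u h ↦ by
    have : ℓ (s u) = 1 := by rw [map_add, hℓx, hℓA, add_zero]
    rw [h, map_zero] at this
    exact zero_ne_one this
  have hinj : ∀ᶠ u in 𝓝 (0 : Euc (n - 2)), Function.Injective (s u : Fin n → ℝ) := by
    have hcont : Continuous fun u ↦ (s u : Fin n → ℝ) :=
      continuous_subtype_val.comp (continuous_const.add A.continuous)
    refine hcont.continuousAt.eventually (isOpen_setOf_injective.mem_nhds ?_)
    change Function.Injective (s 0 : Fin n → ℝ)
    rwa [hs0]
  have hFs : ∀ u, Function.Injective (s u : Fin n → ℝ) → ContinuousAt (fun u ↦ F (s u)) u := by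
    intro u hu
    obtain ⟨L, hL, _⟩ := exists_hasFDerivAt_force hα hm hM hpos hu
    exact (hL.comp u (hs u)).continuousAt
  have hℓF0 : ℓ (F (s 0)) = c := by
    rw [hs0, hFx, map_smul, hℓx, smul_eq_mul, mul_one]
  have hev : ∀ᶠ u in 𝓝 (0 : Euc (n - 2)), ℓ (F (s u)) ≠ 0 := by
    refine (ℓ.continuous.continuousAt.comp (hFs 0 (by rwa [hs0]))).eventually_ne ?_
    exact hℓF0.trans_ne hc.ne'
  let g : Euc (n - 2) → Euc (n - 2) := fun u ↦ (ℓ (F (s u)))⁻¹ • B (F (s u))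
  have hep : e p = 0 := by rw [← hxp, hef, hBx, smul_zero]
  have hBF : B (F (s 0)) = 0 := by rw [hs0, hFx, map_smul, hBx, smul_zero]
  have hg0 : g 0 = 0 := by simp only [g, hBF, smul_zero]
  obtain ⟨L, hL, hLneg⟩ := exists_hasFDerivAt_force hα hm hM hpos hxinj
  have hLs : HasFDerivAt (fun u ↦ F (s u)) (L.comp A) 0 :=
    HasFDerivAt.comp (g := F) 0 (by rw [hs0]; exact hL) (hs 0)
  have hℓd := ℓ.hasFDerivAt.comp 0 hLs
  have hgd := ((hasDerivAt_inv (hℓF0.trans_ne hc.ne')).comp_hasFDerivAt 0 hℓd).smul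
    (B.hasFDerivAt.comp 0 hLs)
  -- The term differentiating `(ℓ F)⁻¹` is multiplied by `B (F x) = c B x = 0`.
  obtain ⟨G, hG, hGv⟩ : ∃ G : Euc (n - 2) →L[ℝ] Euc (n - 2), HasFDerivAt g G 0 ∧
      ∀ v, G v = c⁻¹ • B (L (A v)) := by
    refine ⟨_, hgd, fun v ↦ ?_⟩
    simp [hBF, hℓF0]
  -- As `B` is adjoint to `A`, `⟨v, B L A v⟩` is the kinetic pairing of `A v` with `L (A v)`.
  have hneg : ∀ v, inner ℝ v (G v) ≤ 0 := fun v ↦ by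
    rw [hGv, real_inner_smul_right, ← hadj]
    rcases eq_or_ne v 0 with rfl | hv
    · simp [kinetic]
    · refine (mul_neg_of_pos_of_neg (inv_pos.2 hc) (hLneg (A v) fun h ↦ hv ?_)).le
      rw [← hBA v, h, map_zero]
  have hgc : ∀ᶠ u in 𝓝 (0 : Euc (n - 2)), ContinuousAt g u := by
    filter_upwards [hinj, hev] with u h1 h2
    exact ((ℓ.continuous.continuousAt.comp (hFs u h1)).inv₀ h2).smul
      (B.continuous.continuousAt.comp (hFs u h1))
  -- On this ball `s u` has no collisions and its image stays in the chart domain.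
  obtain ⟨ε, hε, hball⟩ := Metric.eventually_nhds_iff_ball.1 (hinj.and hev)
  obtain ⟨r, hr, hrε⟩ := ((eventually_hasIndexOnBall_one hg0 hG hneg hgc).and
    (Ioo_mem_nhdsGT hε)).exists
  refine ⟨e, r, g, ?_, fun y hy ↦ ⟨he ▸ Set.mem_univ _, ?_⟩, by rwa [hep]⟩
  · rw [← hxp, heS, hℓx]
    exact one_ne_zero
  · rw [hep] at hy
    obtain ⟨h1, h2⟩ := hball y (Metric.closedBall_subset_ball hrε.2 hy)
    have hD : Projectivization.mk ℝ (s y) (hsne y) ∈ configSet m := ⟨s y, hsne y, h1, rfl⟩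
    have hy' : e.symm y = Projectivization.mk ℝ (s y) (hsne y) := hes y (hsne y)
    have hD' : e.symm y ∈ configSet m := hy' ▸ hD
    have hval : collinearMap m M α hm hM hpos ⟨e.symm y, hD'⟩ =
        Projectivization.mk ℝ (F (s y)) (force_ne_zero m M α hm hM hpos _ (hsne y) h1) := by
      have : (⟨e.symm y, hD'⟩ : configSet m) = ⟨_, hD⟩ := Subtype.ext hy'
      rw [this, collinearMap_mk]
    refine ⟨hD', ?_, ?_⟩
    · rw [hval, heS]
      exact h2
    · rw [hval, hef]

end CentralConf

/-! ### The theorem -/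

theorem mainTheorem3 (n : ℕ) (hn : 3 ≤ n) (m : Fin n → ℝ) (hm : ∀ i, 0 < m i)
    (M : Fin n → Fin n → ℝ) (hM : ∀ i j, M i j = M j i) (hpos : ∀ i j, i ≠ j → 0 < M i j)
    (α : ℝ) (hα : α < -1) (p : CentralConf.configSet m)
    (hp : CentralConf.collinearMap m M α hm hM hpos p = p) :
    -- `p` is isolated in the set of fixed points
    (∃ W ∈ nhds p, ∀ q ∈ W, CentralConf.collinearMap m M α hm hM hpos q = q → q = p) ∧
    -- its fixed point index is `1`
    CentralConf.HasFixedPointIndex (n - 2) (CentralConf.collinearMap m M α hm hM hpos) p 1 ∧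
    -- the differential of the lifted map on the ellipsoid, at the points over `p`
    ∀ (x : CentralConf.centered m) (hx : x ≠ 0), Projectivization.mk ℝ x hx = p →
      CentralConf.kinetic m x x = 1 →
      CentralConf.liftedMap m M α hm hM x = x ∧
      ∃ (L : CentralConf.centered m →L[ℝ] CentralConf.centered m)
        (D : CentralConf.tangent m x →ₗ[ℝ] CentralConf.tangent m x),
        HasFDerivAt (CentralConf.liftedMap m M α hm hM) L x ∧
        (∀ v : CentralConf.tangent m x,
          (D v : Fin n → ℝ) = L ⟨v, CentralConf.tangent_le x v.2⟩) ∧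
        (∀ v : CentralConf.tangent m x, v ≠ 0 → CentralConf.kinetic m v (D v) < 0) ∧
        0 < LinearMap.det (LinearMap.id - D) := by
  have hindex := CentralConf.hasFixedPointIndex_collinearMap hα hm hM hpos p hp
  refine ⟨hindex.exists_nhds, hindex, fun x hx hxp hx1 ↦ ?_⟩
  obtain ⟨c, hc, hF⟩ := CentralConf.exists_force_eq_smul hm hM hpos hp hx hxp
  obtain ⟨L, hL, hneg⟩ := CentralConf.exists_hasFDerivAt_force hα hm hM hpos
    (CentralConf.injective_of_mk_mem (hz := hx) (by rw [hxp]; exact p.2))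
  obtain ⟨L', hL', hL'v⟩ := CentralConf.hasFDerivAt_liftedMap hc hF hx1 hL
  have hL'k : ∀ (u : Fin n → ℝ) (v : CentralConf.centered m),
      CentralConf.kinetic m u (L' v) = c⁻¹ * (CentralConf.kinetic m u (L v) -
        CentralConf.kinetic m x (L v) * CentralConf.kinetic m u x) := fun u v ↦ by
    rw [hL'v, Submodule.coe_smul, Submodule.coe_sub, Submodule.coe_smul,
      CentralConf.kinetic_smul_right, CentralConf.kinetic_sub_right, CentralConf.kinetic_smul_right]
  let D : CentralConf.tangent m x →ₗ[ℝ] CentralConf.tangent m x :=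
    LinearMap.codRestrict _ ((CentralConf.centered m).subtype ∘ₗ L'.toLinearMap ∘ₗ
      Submodule.inclusion (CentralConf.tangent_le x)) fun v ↦ ⟨Subtype.prop _, by
        change CentralConf.kinetic m x (L' _) = 0
        rw [hL'k, hx1, mul_one, sub_self, mul_zero]⟩
  have hD : ∀ v : CentralConf.tangent m x,
      (D v : Fin n → ℝ) = L' ⟨v, CentralConf.tangent_le x v.2⟩ := fun _ ↦ rfl
  have hDneg : ∀ v : CentralConf.tangent m x, v ≠ 0 → CentralConf.kinetic m v (D v) < 0 := by
    intro v hv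
    have hvx : CentralConf.kinetic m v x = 0 := (CentralConf.kinetic_comm _ _ _).trans v.2.2
    -- The normal correction is a multiple of `x`, hence invisible when paired with a tangent `v`.
    rw [hD, hL'k, hvx, mul_zero, sub_zero]
    exact mul_neg_of_pos_of_neg (inv_pos.2 hc) (hneg ⟨v, CentralConf.tangent_le x v.2⟩
      fun h ↦ hv (Subtype.ext (congrArg (Submodule.subtype _) h)))
  refine ⟨CentralConf.liftedMap_eq_self hc hF hx1, L', D, hL', hD, hDneg, ?_⟩
  refine CentralConf.det_id_sub_pos ((CentralConf.kineticForm m).compl₁₂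
    (CentralConf.tangent m x).subtype (CentralConf.tangent m x).subtype)
    (fun v hv ↦ CentralConf.kinetic_self_pos hm fun h ↦ hv (Subtype.ext h)) D fun v ↦ ?_
  rcases eq_or_ne v 0 with rfl | hv
  · simp
  · exact (hDneg v hv).le
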